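/- \textbf{Corollary.} For a set $A$, let $A_\star=\{a^\star : a\in A\}$ be a disjoint copy of $A$. For a word $w$ over $A\cup A_\star$, let $w^\star$ be the word obtained by reversing $w$ and exchanging $a$ and $a^\star$ in every position. The free regular $\star$-monoid on $A$, of rank $|A|$, is the monoid $$\mathbf{F}^\star(A)=\mathrm{Mon}\langle A\cup A_\star \mid ww^\star w=w \text{ for all words } w\in(A\cup A_\star)^*\rangle .$$ A monoid $M$ is called \emph{rational} if there are a finite alphabet $B$, a map $B\to M$ with induced homomorphism $\varphi\colon B^*\to M$, and a regular language $L\subseteq B^*$ such that $\varphi$ restricts to a bijection $L\to M$. It is called \emph{automatic} if there are a finite alphabet $B$, a homomorphism $\varphi\colon B^*\to M$, and a regular language $L\subseteq B^*$ with $\varphi(L)=M$ such that the language of padded pairs $(u,v)$ with $u,v\in L$ and $\varphi(u)=\varphi(v)$ is regular, and so is, for each $b\in B$, the language of padded pairs $(u,v)$ with $u,v\in L$ and $\varphi(ub)=\varphi(v)$. Here the padded pair of $u$ and $v$ is the word over $(B\cup\{\$\})\times(B\cup\{\$\})$, with $\$\notin B$ a padding symbol, obtained by reading $u$ and $v$ in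 parallel after filling up the shorter one at its end with $\$$. Then for every non-empty set $A$, finite or infinite, the free regular $\star$-monoid $\mathbf{F}^\star(A)$ is neither rational nor automatic. -/

import Mathlib

namespace RegularStar

/-- The involution on words over the alphabet `A ∪ A⋆`, where `Sum.inl a` is the letter `a` and
`Sum.inr a` is the letter `a⋆`: reverse the word and exchange `a` and `a⋆` in each position. -/
def starWord {A : Type*} (w : FreeMonoid (A ⊕ A)) : FreeMonoid (A ⊕ A) :=
  FreeMonoid.ofList ((w.toList.map Sum.swap).reverse)

/-- The defining relations `w w⋆ w = w`, one for every word `w` over `A ∪ A⋆`. -/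
inductive Rel (A : Type*) : FreeMonoid (A ⊕ A) → FreeMonoid (A ⊕ A) → Prop
  | intro (w : FreeMonoid (A ⊕ A)) : Rel A (w * starWord w * w) w

/-- The free regular ⋆-monoid on the set `A`, as the monoid presented by
`⟨A ∪ A⋆ ∣ w w⋆ w = w for all words w⟩`. -/
abbrev FreeRegularStarMonoid (A : Type*) : Type _ := PresentedMonoid (Rel A)

/-- The element of `M` represented by the word `w` over `B`, when the letters are read
through `f : B → M`. -/
def eval {B M : Type*} [Monoid M] (f : B → M) (w : List B) : M := (w.map f).prod

/-- A monoid is rational if it has a regular language of unique normal forms: a regular language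
over a finite alphabet such that each element of the monoid is represented by exactly
one word of the language. -/
def IsRational (M : Type*) [Monoid M] : Prop :=
  ∃ (B : Type) (_ : Finite B) (f : B → M) (L : Language B),
    L.IsRegular ∧ ∀ m : M, ∃! w : List B, w ∈ L ∧ eval f w = m

/-- The padded pair of two words: they are read in parallel, one letter at a time, and the shorter
one is filled up at its end with the padding symbol `none`. -/
def padPair {B : Type*} : List B → List B → List (Option B × Option B)
  | [], [] => []
  | a :: u, [] => (some a, none) :: padPair u []
  | [], b :: v => (none, some b) :: padPair [] v
  | a :: u, b :: v => (some a, some b) :: padPair u v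

/-- The language of the padded pairs `(u, v)` with `u, v ∈ L` and `R u v`. -/
def pairLanguage {B : Type*} (L : Language B) (R : List B → List B → Prop) :
    Language (Option B × Option B) :=
  {x : List (Option B × Option B) | ∃ u ∈ L, ∃ v ∈ L, R u v ∧ padPair u v = x}

/-- A monoid is automatic if there is a regular language `L` over a finite alphabet `B`
representing every element, such that finite automata reading padded pairs of words of `L` decide
whether `u = v` in the monoid and, for each generator `b`, whether `u b = v` in the monoid. -/
def IsAutomatic (M : Type*) [Monoid M] : Prop :=
  ∃ (B : Type) (_ : Finite B) (f : B → M) (L : Language B),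
    L.IsRegular ∧ (∀ m : M, ∃ w ∈ L, eval f w = m) ∧
      (pairLanguage L fun u v => eval f u = eval f v).IsRegular ∧
      ∀ b : B, (pairLanguage L fun u v => eval f u * f b = eval f v).IsRegular

end RegularStar

/-!
An automatic monoid has a regular language of unique normal forms, the shortlex-least words of its
language (`IsAutomatic.isRational`), so it is enough to show that the free regular ⋆-monoid has no
such language (`not_isRational`).

Fix a letter `a`. The words over the letters whose values lie in the submonoid `N` generated by
`a` and `a⋆` are again a regular language of unique normal forms, this time of `N`
(`mem_closure_of_eval_mem`). An element of `N` is given by a path on the integers with up-steps `a`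
and down-steps `a⋆`, and the relations `aᵏ (a⋆)ᵏ aᵏ = aᵏ` show that a path from its minimum
to its maximum may be replaced by a straight one (`InversePowers.pathEval_of_rising`). It follows
that

* no two elements of `N` generate a free monoid of rank two (`InversePowers.not_free`);
* the powers of an element of `N` are products of boundedly many powers of `a` and of `a⋆`
  (`InversePowers.exists_pow_mem_runs`).

In an automaton for the normal forms, two loops at a state that lies on the path of an accepted
word commute by the first item, hence all loops at this state are powers of one of them. By the
second item the values of the accepted words, thus all elements of `N`, are products of boundedly
many powers of `a` and of `a⋆` (`exists_eval_mem_pow`).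

This is absurd. Along a path, register the steps that lead to a new maximum or a new minimum. The
passage from `w` to `w w⋆ w` does not change this sequence, because `w⋆` retraces `w`
(`RecordState.run_retrace`), so that the number of its alternations between maxima and minima is
an invariant of the element. It is at most the number of factors in a product of powers of `a`
and of `a⋆`, while oscillations of growing width make it as large as one likes
(`exists_mem_closure_notMem_runs_pow`).
-/

namespace RegularStar

open scoped Pointwise

/-! ### Values of words -/

section Eval

variable {B M : Type*} [Monoid M] (f : B → M)

@[simp] theorem eval_nil : eval f [] = 1 := rfl

@[simp] theorem eval_cons (b : B) (w : List B) : eval f (b :: w) = f b * eval f w := by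
  simp [eval]

@[simp] theorem eval_append (u v : List B) : eval f (u ++ v) = eval f u * eval f v := by
  simp [eval]

theorem eval_flatten_replicate (k : ℕ) (w : List B) :
    eval f (List.replicate k w).flatten = eval f w ^ k := by
  induction k with
  | zero => simp
  | succ k ih => simp [List.replicate_succ, ih, pow_succ']

theorem eval_mem (N : Submonoid M) {w : List B} (h : ∀ b ∈ w, f b ∈ N) : eval f w ∈ N :=
  N.list_prod_mem (by simpa using h)

end Eval

/-! ### Lattice paths -/

/-- The step of a letter, `1` for `true` and `-1` for `false`. -/
def sgn (c : Bool) : ℤ := if c then 1 else -1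

@[simp] theorem sgn_true : sgn true = 1 := rfl
@[simp] theorem sgn_false : sgn false = -1 := rfl

/-- The height at which the path `w` ends. A word over `Bool` is read as a path on the integers
that begins at `0`, with an up-step for each `true` and a down-step for each `false`. -/
def height : List Bool → ℤ
  | [] => 0
  | c :: w => sgn c + height w

@[simp] theorem height_nil : height [] = 0 := rfl

@[simp] theorem height_cons (c : Bool) (w : List Bool) : height (c :: w) = sgn c + height w := rfl

@[simp] theorem height_append (u v : List Bool) : height (u ++ v) = height u + height v := by
  induction u with
  | nil => simp
  | cons c u ih => simp [ih, add_assoc]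

@[simp] theorem height_flatten_replicate (k : ℕ) (w : List Bool) :
    height (List.replicate k w).flatten = k * height w := by
  induction k with
  | zero => simp
  | succ k ih => simp [List.replicate_succ, ih]; ring

@[simp] theorem height_map_not (w : List Bool) : height (w.map not) = -height w := by
  induction w with
  | nil => simp
  | cons c u ih => cases c <;> simp [ih, add_comm]

/-- The path `w` stays in the interval from `l` to `r`. -/
def Within (l r : ℤ) : List Bool → Prop
  | [] => l ≤ 0 ∧ 0 ≤ r
  | c :: w => (l ≤ 0 ∧ 0 ≤ r) ∧ Within (l - sgn c) (r - sgn c) w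

@[simp] theorem within_nil {l r : ℤ} : Within l r [] ↔ l ≤ 0 ∧ 0 ≤ r := Iff.rfl

@[simp] theorem within_cons {l r : ℤ} {c : Bool} {w : List Bool} :
    Within l r (c :: w) ↔ (l ≤ 0 ∧ 0 ≤ r) ∧ Within (l - sgn c) (r - sgn c) w := Iff.rfl

theorem Within.nonneg {l r : ℤ} {w : List Bool} (h : Within l r w) : l ≤ 0 ∧ 0 ≤ r := by
  cases w with
  | nil => exact h
  | cons c w => exact h.1

theorem Within.mono {l r l' r' : ℤ} {w : List Bool} (h : Within l r w) (hl : l' ≤ l)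
    (hr : r ≤ r') : Within l' r' w := by
  induction w generalizing l r l' r' with
  | nil => simp at *; omega
  | cons c w ih =>
    simp only [within_cons] at *
    exact ⟨by omega, ih h.2 (by omega) (by omega)⟩

theorem within_append {l r : ℤ} {u v : List Bool} :
    Within l r (u ++ v) ↔ Within l r u ∧ Within (l - height u) (r - height u) v := by
  induction u generalizing l r with
  | nil => simpa using fun h : Within l r v => h.nonneg
  | cons c u ih =>
    simp only [List.cons_append, within_cons, ih, height_cons, and_assoc, sub_sub]

theorem Within.inter {l r l' r' : ℤ} {w : List Bool} (h : Within l r w) (h' : Within l' r' w) :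
    Within l r' w := by
  induction w generalizing l r l' r' with
  | nil => simp at *; omega
  | cons c w ih =>
    simp only [within_cons] at *
    exact ⟨by omega, ih h.2 h'.2⟩

theorem within_map_not {l r : ℤ} {w : List Bool} :
    Within l r (w.map not) ↔ Within (-r) (-l) w := by
  induction w generalizing l r with
  | nil => simp [and_comm]
  | cons c w ih =>
    have e (x : ℤ) : -(x - sgn (!c)) = -x - sgn c := by cases c <;> simp [sub_eq_add_neg, add_comm]
    simp only [List.map_cons, within_cons, ih, e]
    refine and_congr ?_ Iff.rfl
    omega

theorem Within.height_mem {l r : ℤ} {w : List Bool} (h : Within l r w) :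
    l ≤ height w ∧ height w ≤ r := by
  have := (within_append.1 (by simpa using h : Within l r (w ++ []))).2
  simp at this; omega

theorem within_length (w : List Bool) : Within (-w.length) w.length w := by
  induction w with
  | nil => simp
  | cons c w ih =>
    refine ⟨by simp; omega, ih.mono ?_ ?_⟩ <;> cases c <;> simp [add_assoc]

theorem exists_min_prefix (w : List Bool) :
    ∃ p q, w = p ++ q ∧ ∃ r, Within (height p) r w := by
  induction w with
  | nil => exact ⟨[], [], rfl, 0, by simp⟩
  | cons c w ih =>
    obtain ⟨p, q, rfl, r, h⟩ := ih
    by_cases hc : sgn c + height p ≤ 0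
    · exact ⟨c :: p, q, rfl, max 0 (r + sgn c), ⟨by simp; omega, h.mono (by simp) (by omega)⟩⟩
    · exact ⟨[], c :: (p ++ q), rfl, max 0 (r + sgn c),
        ⟨by simp, h.mono (by simp; omega) (by omega)⟩⟩

theorem exists_max_prefix (w : List Bool) :
    ∃ p q, w = p ++ q ∧ ∃ l, Within l (height p) w := by
  obtain ⟨p, q, hw, r, h⟩ := exists_min_prefix (w.map not)
  refine ⟨p.map not, q.map not, ?_, -r, ?_⟩
  · rw [← List.map_append, ← hw]; simp [Function.comp_def]
  · rw [within_map_not] at h; simpa using h.mono le_rfl (by simp)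

/-- First passage: a path that ends above the level `n ≥ 0` is cut where it first climbs from `n`
to `n + 1`. -/
theorem exists_first_passage {v : List Bool} {n l r : ℤ} (hn : 0 ≤ n) (hv : Within l r v)
    (h : n + 1 ≤ height v) : ∃ y z, v = y ++ true :: z ∧ height y = n ∧ Within l n y := by
  induction v generalizing n l r with
  | nil => simp at h; omega
  | cons c v ih =>
    obtain ⟨hlr, hv⟩ := hv
    cases c with
    | true =>
      rcases hn.eq_or_lt with rfl | hn
      · exact ⟨[], v, rfl, rfl, by simp; omega⟩
      · obtain ⟨y, z, rfl, hy, hw⟩ := ih (n := n - 1) (by omega) hv (by simp at h; omega)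
        exact ⟨true :: y, z, rfl, by simp [hy], by simpa using ⟨by omega, hw⟩⟩
    | false =>
      obtain ⟨y, z, rfl, hy, hw⟩ := ih (n := n + 1) (by omega) hv (by simp at h; omega)
      exact ⟨false :: y, z, rfl, by simp [hy], by simpa using ⟨by omega, hw⟩⟩

/-! ### Pairs of elements with mutually inverse powers -/

/-- The powers `α ^ k` and `β ^ k` are inverse to each other, in the sense of regular semigroups,
for each `k`. -/
structure InversePowers {M : Type*} [Monoid M] (α β : M) : Prop where
  left : ∀ k : ℕ, α ^ k * β ^ k * α ^ k = α ^ k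
  right : ∀ k : ℕ, β ^ k * α ^ k * β ^ k = β ^ k

/-- The element of `M` obtained by reading `true` as `α` and `false` as `β`. -/
def pathEval {M : Type*} [Monoid M] (α β : M) (w : List Bool) : M :=
  eval (fun c : Bool => cond c α β) w

section PathEval

variable {M : Type*} [Monoid M] (α β : M)

@[simp] theorem pathEval_nil : pathEval α β [] = 1 := rfl

@[simp] theorem pathEval_true (w : List Bool) :
    pathEval α β (true :: w) = α * pathEval α β w := eval_cons ..

@[simp] theorem pathEval_false (w : List Bool) :
    pathEval α β (false :: w) = β * pathEval α β w := eval_cons ..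

@[simp] theorem pathEval_append (u v : List Bool) :
    pathEval α β (u ++ v) = pathEval α β u * pathEval α β v := eval_append ..

@[simp] theorem pathEval_flatten_replicate (k : ℕ) (w : List Bool) :
    pathEval α β (List.replicate k w).flatten = pathEval α β w ^ k :=
  eval_flatten_replicate ..

theorem pathEval_map_not (w : List Bool) : pathEval β α (w.map not) = pathEval α β w := by
  induction w with
  | nil => rfl
  | cons c w ih => cases c <;> simp [ih]

end PathEval

namespace InversePowers

variable {M : Type*} [Monoid M] {α β : M}

theorem symm (h : InversePowers α β) : InversePowers β α := ⟨h.right, h.left⟩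

theorem absorb (h : InversePowers α β) {j m : ℕ} (hjm : j ≤ m) :
    α ^ m * (β ^ j * α ^ j) = α ^ m := by
  obtain ⟨d, rfl⟩ := Nat.exists_eq_add_of_le' hjm
  rw [pow_add, mul_assoc, ← mul_assoc (α ^ j), h.left]

theorem absorb_left (h : InversePowers α β) {j m : ℕ} (hjm : j ≤ m) :
    β ^ j * α ^ j * β ^ m = β ^ m := by
  obtain ⟨d, rfl⟩ := Nat.exists_eq_add_of_le hjm
  rw [pow_add, ← mul_assoc, h.right]

theorem mul_projections (h : InversePowers α β) (i j : ℕ) :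
    β ^ i * α ^ i * (β ^ j * α ^ j) = β ^ (max i j) * α ^ (max i j) := by
  rcases le_total i j with hij | hij
  · rw [max_eq_right hij, ← mul_assoc, h.absorb_left hij]
  · rw [max_eq_left hij, mul_assoc, h.absorb hij]

/-- A loop that stays below its base point depends on its depth only. -/
theorem pathEval_loop (h : InversePowers α β) (y : List Bool) (k : ℕ) (hy : height y = 0)
    (hw : Within (-k) 0 y) : ∃ j ≤ k, pathEval α β y = β ^ j * α ^ j := by
  match y with
  | [] => exact ⟨0, by simp, by simp⟩
  | true :: y => have := hw.2.nonneg; simp at this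
  | false :: y =>
    obtain ⟨_, hw⟩ := hw
    obtain ⟨s, z, e, hs, hws⟩ := exists_first_passage le_rfl hw (by simp at hy; omega)
    rw [e] at hy hw ⊢
    have hk := hws.nonneg
    obtain ⟨k, rfl⟩ : ∃ k', k = k' + 1 := ⟨k - 1, by simp at hk; omega⟩
    obtain ⟨j, hj, ej⟩ := h.pathEval_loop s k hs (hws.mono (by simp) le_rfl)
    obtain ⟨i, hi, ei⟩ := h.pathEval_loop z (k + 1) (by simp [hs] at hy; omega)
      (by have := (within_append.1 hw).2; rw [within_cons] at this
          exact this.2.mono (by simp [hs]) (by simp [hs]))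
    refine ⟨max (j + 1) i, by omega, ?_⟩
    rw [← h.mul_projections, ← ei]
    simp [ej, pow_succ α j, pow_succ' β j, mul_assoc]
  termination_by y.length
  decreasing_by all_goals simp [*] <;> omega

theorem pow_mul_pathEval (h : InversePowers α β) (v : List Bool) (m : ℕ)
    (hv : Within (-m) (height v) v) :
    α ^ m * pathEval α β v = α ^ (m + height v).toNat := by
  match v with
  | [] => simp
  | true :: v =>
    have := h.pow_mul_pathEval v (m + 1) (hv.2.mono (by simp) (by simp))
    rw [pathEval_true, ← mul_assoc, ← pow_succ, this]
    congr 2; simp; ring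
  | false :: v =>
    obtain ⟨hm, hw⟩ := hv
    obtain ⟨s, z, e', hs, hws⟩ := exists_first_passage le_rfl hw (by simp at hm ⊢; omega)
    rw [e'] at hw ⊢
    have hk := hws.nonneg
    obtain ⟨m, rfl⟩ : ∃ k', m = k' + 1 := ⟨m - 1, by simp at hk; omega⟩
    obtain ⟨j, hj, ej⟩ := h.pathEval_loop s m hs (hws.mono (by simp) le_rfl)
    have := h.pow_mul_pathEval z (m + 1)
      (by have := (within_append.1 hw).2; rw [within_cons] at this
          exact this.2.mono (by simp [hs]) (by simp [hs]))
    have e : α ^ (m + 1) * (β * (β ^ j * α ^ j * (α * pathEval α β z))) =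
        α ^ (m + 1) * (β ^ (j + 1) * α ^ (j + 1)) * pathEval α β z := by
      simp [pow_succ α j, pow_succ' β j, mul_assoc]
    rw [pathEval_false, pathEval_append, pathEval_true, ej, e, h.absorb (by omega), this]
    congr 2; simp [hs]
  termination_by v.length
  decreasing_by all_goals simp [*] <;> omega

/-- A path that ends at its maximum and never goes below its beginning is worth the straight
path between the two. -/
theorem pathEval_of_rising (h : InversePowers α β) {v : List Bool}
    (hv : Within 0 (height v) v) : pathEval α β v = α ^ (height v).toNat := by
  simpa using h.pow_mul_pathEval v 0 (by simpa using hv)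

theorem pathEval_of_falling (h : InversePowers α β) {v : List Bool}
    (hv : Within (height v) 0 v) : pathEval α β v = β ^ (-height v).toNat := by
  rw [← pathEval_map_not, h.symm.pathEval_of_rising (by rw [within_map_not]; simpa using hv),
    height_map_not]

/-- A closed path takes only finitely many values on its powers: between the first visit to the
minimum and the last one, all that matters is that the maximum is reached. -/
theorem pathEval_pow_three (h : InversePowers α β) {x : List Bool} (hx : height x = 0) :
    pathEval α β x ^ 3 = pathEval α β x ^ 4 := by
  obtain ⟨p, p', hp, r', hl⟩ := exists_min_prefix x
  obtain ⟨s, s', hs, l', hr⟩ := exists_max_prefix x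
  have hw := hl.inter hr
  have h0 := hw.nonneg
  have hw1 := within_append.1 (hp ▸ hw)
  have hw2 := within_append.1 (hs ▸ hw)
  have hx1 : height p + height p' = 0 := by rw [← height_append, ← hp, hx]
  have hx2 : height s + height s' = 0 := by rw [← height_append, ← hs, hx]
  have up : pathEval α β p' * pathEval α β s = α ^ (height s - height p).toNat := by
    rw [← pathEval_append, h.pathEval_of_rising]
    · congr 2; simp; omega
    · refine within_append.2 ⟨hw1.2.mono ?_ ?_, hw2.1.mono ?_ ?_⟩ <;> simp <;> omega
  have down : pathEval α β s' * pathEval α β p = β ^ (height s - height p).toNat := by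
    rw [← pathEval_append, h.pathEval_of_falling]
    · congr 2; simp; omega
    · refine within_append.2 ⟨hw2.2.mono ?_ ?_, hw1.1.mono ?_ ?_⟩ <;> simp <;> omega
  have down' : pathEval α β s' * (pathEval α β x * pathEval α β p) =
      β ^ (height s - height p).toNat := by
    rw [← pathEval_append, ← pathEval_append, h.pathEval_of_falling]
    · congr 2; simp; omega
    · refine within_append.2 ⟨hw2.2.mono ?_ ?_, within_append.2 ⟨hw.mono ?_ ?_, hw1.1.mono ?_ ?_⟩⟩
        <;> simp <;> omega
  have e1 : pathEval α β x = pathEval α β p * pathEval α β p' := by rw [← pathEval_append, ← hp]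
  have e2 : pathEval α β x = pathEval α β s * pathEval α β s' := by rw [← pathEval_append, ← hs]
  set X := pathEval α β x
  calc X ^ 3 = X * X * X := by rw [pow_succ, pow_two]
    _ = pathEval α β p * (pathEval α β p' * pathEval α β s) *
          (pathEval α β s' * pathEval α β p) * pathEval α β p' := by
        nth_rewrite 2 [e2]; rw [e1]; simp only [mul_assoc]
    _ = pathEval α β p * (pathEval α β p' * pathEval α β s) *
          (pathEval α β s' * (X * pathEval α β p)) * pathEval α β p' := by rw [down, down']
    _ = (pathEval α β p * pathEval α β p') * (pathEval α β s * pathEval α β s') * X *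
          (pathEval α β p * pathEval α β p') := by simp only [mul_assoc]
    _ = X ^ 4 := by rw [← e1, ← e2]; simp only [pow_succ, pow_zero, one_mul]

/-- Put between two copies of a path `x` of positive height, a path `v` that does not leave the
range spanned by them contributes through its height only. Here `l + height x` is the minimum of `x`
and `r` is its maximum. -/
theorem exists_pathEval_sandwich (h : InversePowers α β) {x : List Bool} (hx : 0 < height x) :
    ∃ (p q : List Bool) (c l r : ℤ), Within (l + height x) r x ∧ ∀ v : List Bool, 0 ≤ height v →
      Within l (height v + r) v → pathEval α β x * pathEval α β v * pathEval α β x =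
        pathEval α β p * α ^ (c + height v).toNat * pathEval α β q := by
  obtain ⟨p, p', hp, r', hl⟩ := exists_min_prefix x
  obtain ⟨s, s', hs, l', hr⟩ := exists_max_prefix x
  have hw := hl.inter hr
  have h0 := hw.nonneg
  have hw1 := within_append.1 (hp ▸ hw)
  have hw2 := within_append.1 (hs ▸ hw)
  have hx1 : height p + height p' = height x := by rw [← height_append, ← hp]
  refine ⟨p, s', height p' + height s, height p - height x, height s, by simpa using hw,
    fun v hv hvw => ?_⟩
  have mid : pathEval α β p' * (pathEval α β v * pathEval α β s) =
      α ^ (height p' + height s + height v).toNat := by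
    rw [← pathEval_append, ← pathEval_append, h.pathEval_of_rising]
    · congr 2; simp; omega
    · refine within_append.2 ⟨hw1.2.mono ?_ ?_,
        within_append.2 ⟨hvw.mono ?_ ?_, hw2.1.mono ?_ ?_⟩⟩ <;> simp <;> omega
  have e1 : pathEval α β x = pathEval α β p * pathEval α β p' := by rw [← pathEval_append, ← hp]
  have e2 : pathEval α β x = pathEval α β s * pathEval α β s' := by rw [← pathEval_append, ← hs]
  rw [← mid]
  nth_rewrite 2 [e2]
  rw [e1]
  simp only [mul_assoc]

theorem within_flatten_replicate {x : List Bool} {l r : ℤ} (hx : 0 < height x)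
    (hw : Within (l + height x) r x) (k : ℕ) :
    Within l (k * height x + r) (List.replicate k x).flatten := by
  have h0 := hw.nonneg
  induction k with
  | zero => simp; omega
  | succ k ih =>
    have hk : 0 ≤ (k : ℤ) * height x := by positivity
    rw [List.replicate_succ, List.flatten_cons, within_append]
    refine ⟨hw.mono (by omega) ?_, ih.mono (by omega) ?_⟩ <;> push_cast <;> linarith

/-- Powers of a path of positive height swallow every path between them. -/
theorem exists_pow_mul_comm_of_pos (h : InversePowers α β) {x : List Bool} (hx : 0 < height x)
    (y : List Bool) : ∃ n : ℕ,
      pathEval α β x ^ n * pathEval α β y * pathEval α β x ^ (n + 1) =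
        pathEval α β x ^ (n + 1) * pathEval α β y * pathEval α β x ^ n := by
  obtain ⟨p, q, c, l, r, hw, key⟩ := h.exists_pathEval_sandwich (x := x) hx
  have h0 := hw.nonneg
  have hy := within_length y
  have hy' := hy.height_mem
  have fit (m n : ℕ) (hm : 2 * y.length ≤ m) (hn : 2 * y.length ≤ n) := by
    have hm' : (2 * y.length : ℤ) ≤ m * height x := by nlinarith
    have hn' : (2 * y.length : ℤ) ≤ n * height x := by nlinarith
    refine key ((List.replicate m x).flatten ++ (y ++ (List.replicate n x).flatten)) ?_ ?_
    · simp; omega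
    · refine within_append.2 ⟨(within_flatten_replicate hx hw m).mono ?_ ?_,
        within_append.2 ⟨hy.mono ?_ ?_, (within_flatten_replicate hx hw n).mono ?_ ?_⟩⟩ <;>
      simp <;> omega
  have e := (fit (2 * y.length) (2 * y.length + 1) le_rfl (by omega)).trans
    ((fit (2 * y.length + 1) (2 * y.length) (by omega) le_rfl).trans ?_).symm
  · refine ⟨2 * y.length + 1, ?_⟩
    simp only [pathEval_append, pathEval_flatten_replicate] at e
    set n := 2 * y.length
    set X := pathEval α β x
    calc _ = X * (X ^ n * (pathEval α β y * X ^ (n + 1))) * X := by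
          rw [pow_succ X (n + 1)]; simp only [pow_succ' X n, mul_assoc]
      _ = _ := by
          rw [e, pow_succ' X (n + 1)]; simp only [pow_succ X n, mul_assoc]
  · congr 3
    simp
    congr 1
    ring

/-! ### The submonoid generated by such a pair -/

theorem exists_pathEval_eq {X : M} (hX : X ∈ Submonoid.closure {α, β}) :
    ∃ w, pathEval α β w = X := by
  induction hX using Submonoid.closure_induction with
  | mem x hx =>
    rcases hx with rfl | rfl
    · exact ⟨[true], by simp⟩
    · exact ⟨[false], by simp⟩
  | one => exact ⟨[], rfl⟩
  | mul x y _ _ hx hy =>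
    obtain ⟨u, rfl⟩ := hx
    obtain ⟨v, rfl⟩ := hy
    exact ⟨u ++ v, by simp⟩

/-- No two elements of the submonoid generated by `α` and `β` generate a free submonoid of
rank two. -/
theorem not_free (h : InversePowers α β) {X Y : M} (hX : X ∈ Submonoid.closure {α, β})
    (hY : Y ∈ Submonoid.closure {α, β}) :
    (∃ n : ℕ, X ^ n * Y * X ^ (n + 1) = X ^ (n + 1) * Y * X ^ n) ∨ X ^ 3 = X ^ 4 := by
  obtain ⟨x, rfl⟩ := exists_pathEval_eq hX
  obtain ⟨y, rfl⟩ := exists_pathEval_eq hY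
  rcases lt_trichotomy (height x) 0 with hx | hx | hx
  · rw [← pathEval_map_not α β x, ← pathEval_map_not α β y]
    exact .inl (h.symm.exists_pow_mul_comm_of_pos (by simpa using hx) _)
  · exact .inr (h.pathEval_pow_three hx)
  · exact .inl (h.exists_pow_mul_comm_of_pos hx y)

end InversePowers

/-- The powers of `α` and of `β`, so that `runs α β ^ n` consists of the products of `n` factors
of this form. -/
def runs {M : Type*} [Monoid M] (α β : M) : Set M := {x | ∃ k : ℕ, x = α ^ k ∨ x = β ^ k}

section Runs

variable {M : Type*} [Monoid M] (α β : M)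

theorem one_mem_runs : 1 ∈ runs α β := ⟨0, by simp⟩

theorem runs_comm : runs α β = runs β α := by
  ext x; simp [runs, or_comm]

theorem pathEval_mem_runs_pow (w : List Bool) : pathEval α β w ∈ runs α β ^ w.length := by
  induction w with
  | nil => simp
  | cons c w ih =>
    rw [List.length_cons, pow_succ']
    cases c
    · exact Set.mul_mem_mul ⟨1, by simp⟩ ih
    · exact Set.mul_mem_mul ⟨1, by simp⟩ ih

variable {α β}

theorem InversePowers.exists_pow_mem_runs_of_pos (h : InversePowers α β) {x : List Bool}
    (hx : 0 < height x) : ∃ n, ∀ k, pathEval α β x ^ k ∈ runs α β ^ n := by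
  obtain ⟨p, q, c, l, r, hw, key⟩ := h.exists_pathEval_sandwich (x := x) hx
  refine ⟨p.length + 1 + q.length + x.length, fun k => ?_⟩
  match k with
  | 0 =>
    exact Set.pow_subset_pow_right (one_mem_runs α β) (Nat.zero_le _) (by simp)
  | 1 =>
    exact Set.pow_subset_pow_right (one_mem_runs α β) (Nat.le_add_left ..)
      (by simpa using pathEval_mem_runs_pow α β x)
  | k + 2 =>
    have e := key (List.replicate k x).flatten (by simp; positivity)
      (by simpa using within_flatten_replicate hx hw k)
    rw [pathEval_flatten_replicate, ← pow_succ', ← pow_succ] at e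
    rw [e]
    refine Set.pow_subset_pow_right (one_mem_runs α β) (Nat.le_add_right ..) ?_
    rw [pow_add, pow_succ]
    exact Set.mul_mem_mul (Set.mul_mem_mul (pathEval_mem_runs_pow α β p) ⟨_, .inl rfl⟩)
      (pathEval_mem_runs_pow α β q)

/-- The powers of one element of the submonoid generated by `α` and `β` have boundedly many
runs. -/
theorem InversePowers.exists_pow_mem_runs (h : InversePowers α β) {X : M}
    (hX : X ∈ Submonoid.closure {α, β}) : ∃ n, ∀ k, X ^ k ∈ runs α β ^ n := by
  obtain ⟨x, rfl⟩ := exists_pathEval_eq hX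
  rcases lt_trichotomy (height x) 0 with hx | hx | hx
  · rw [← pathEval_map_not α β x, runs_comm]
    exact h.symm.exists_pow_mem_runs_of_pos (by simpa using hx)
  · have e := h.pathEval_pow_three hx
    have e' (k : ℕ) : ∃ j ≤ 3, pathEval α β x ^ k = pathEval α β x ^ j := by
      induction k with
      | zero => exact ⟨0, by simp, rfl⟩
      | succ k ih =>
        obtain ⟨j, hj, ih⟩ := ih
        rcases hj.lt_or_eq with hj | rfl
        · exact ⟨j + 1, hj, by rw [pow_succ, ih, ← pow_succ]⟩
        · exact ⟨3, le_rfl, by rw [pow_succ, ih, ← pow_succ, e]⟩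
    refine ⟨x.length * 3, fun k => ?_⟩
    obtain ⟨j, hj, ej⟩ := e' k
    rw [ej]
    refine Set.pow_subset_pow_right (one_mem_runs α β) (Nat.mul_le_mul_left _ hj) ?_
    rw [pow_mul]
    exact Set.pow_mem_pow (pathEval_mem_runs_pow α β x)
  · exact h.exists_pow_mem_runs_of_pos hx

end Runs

/-! ### Counting the alternations of records -/

/-- A point moving on the integers, together with the record of its past: its distances `below` and
`above` to the minimum and the maximum visited so far, the direction `last` in which a record was
broken last (`true` for upwards), and the number `count` of changes of that direction. -/
@[ext]
structure RecordState where
  below : ℕ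
  above : ℕ
  last : Bool
  count : ℕ

namespace RecordState

/-- The change of the state under an up-step (`true`) or a down-step (`false`). -/
def move : Bool → RecordState → RecordState
  | true, s => if s.above = 0 then ⟨s.below + 1, 0, true, s.count + cond s.last 0 1⟩
      else ⟨s.below + 1, s.above - 1, s.last, s.count⟩
  | false, s => if s.below = 0 then ⟨0, s.above + 1, false, s.count + cond s.last 1 0⟩
      else ⟨s.below - 1, s.above + 1, s.last, s.count⟩

/-- The change of the state along a path. -/
def run (s : RecordState) (w : List Bool) : RecordState := w.foldl (fun s c => move c s) s

@[simp] theorem run_nil (s : RecordState) : s.run [] = s := rfl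

@[simp] theorem run_cons (s : RecordState) (c : Bool) (w : List Bool) :
    s.run (c :: w) = (move c s).run w := rfl

@[simp] theorem run_append (s : RecordState) (u v : List Bool) :
    s.run (u ++ v) = (s.run u).run v := by simp [run]

/-- Retracing a path backwards breaks no record, and neither does walking it again. -/
theorem run_retrace (w : List Bool) (s : RecordState) :
    let t := (s.run w).run (w.map not).reverse
    t.run w = s.run w ∧ t.below + t.above = (s.run w).below + (s.run w).above ∧
      t.last = (s.run w).last ∧ t.count = (s.run w).count ∧
        s.below ≤ t.below ∧ s.above ≤ t.above := by
  induction w generalizing s with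
  | nil => simp
  | cons c w ih =>
    obtain ⟨h1, h2, h3, h4, h5, h6⟩ := ih (move c s)
    simp only [List.map_cons, List.reverse_cons, run_append, run_cons, run_nil]
    generalize ((move c s).run w).run (w.map not).reverse = t at *
    have key : move c (move (!c) t) = t ∧
        (move (!c) t).below + (move (!c) t).above = t.below + t.above ∧
        (move (!c) t).last = t.last ∧ (move (!c) t).count = t.count ∧
        s.below ≤ (move (!c) t).below ∧ s.above ≤ (move (!c) t).above := by
      clear h1 h2 h3 h4
      obtain ⟨a, b, d, n⟩ := t
      cases c <;> simp only [move] at h5 h6 ⊢ <;> grind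
    obtain ⟨k1, k2, k3, k4, k5, k6⟩ := key
    rw [k1]
    exact ⟨h1, k2.trans h2, k3.trans h3, k4.trans h4, k5, k6⟩

/-- A run of steps in one direction contributes at most one change of direction of the records. -/
theorem count_run_replicate (s : RecordState) (c : Bool) (k : ℕ) :
    ((s.run (List.replicate k c)).count = s.count ∧
      (s.run (List.replicate k c)).last = s.last) ∨
    ((s.run (List.replicate k c)).count ≤ s.count + 1 ∧
      (s.run (List.replicate k c)).last = c) := by
  induction k with
  | zero => simp
  | succ k ih =>
    rw [List.replicate_succ', run_append, run_cons, run_nil]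
    generalize s.run (List.replicate k c) = t at *
    obtain ⟨a, b, d, n⟩ := t
    cases c <;> simp only [move] at ih ⊢ <;> grind

theorem count_run_replicate_le (s : RecordState) (c : Bool) (k : ℕ) :
    (s.run (List.replicate k c)).count ≤ s.count + 1 := by
  have := s.count_run_replicate c k
  omega

theorem run_replicate_true (s : RecordState) (k : ℕ) :
    s.run (List.replicate (s.above + 1 + k) true) =
      ⟨s.below + s.above + 1 + k, 0, true, s.count + cond s.last 0 1⟩ := by
  obtain ⟨a, b, d, n⟩ := s
  dsimp only
  induction b generalizing a with
  | zero =>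
    induction k with
    | zero => simp [move]
    | succ k ih => rw [← add_assoc, List.replicate_succ', run_append, ih]; simp [move]; omega
  | succ b ih =>
    rw [show b + 1 + 1 + k = b + 1 + k + 1 by ring, List.replicate_succ, run_cons]
    simp only [move]
    simp [ih]; omega

theorem run_replicate_false (s : RecordState) (k : ℕ) :
    s.run (List.replicate (s.below + 1 + k) false) =
      ⟨0, s.below + s.above + 1 + k, false, s.count + cond s.last 1 0⟩ := by
  obtain ⟨a, b, d, n⟩ := s
  dsimp only
  induction a generalizing b with
  | zero =>
    induction k with
    | zero => simp [move]
    | succ k ih => rw [← add_assoc, List.replicate_succ', run_append, ih]; simp [move]; omega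
  | succ a ih =>
    rw [show a + 1 + 1 + k = a + 1 + k + 1 by ring, List.replicate_succ, run_cons]
    simp only [move]
    simp [ih]; omega

/-- Ever wider oscillations, `n` times up and down. -/
def oscillation : ℕ → List Bool
  | 0 => []
  | n + 1 => oscillation n ++ (List.replicate (2 * n + 1) true ++ List.replicate (2 * n + 2) false)

theorem run_oscillation (n : ℕ) :
    RecordState.run ⟨0, 0, false, 0⟩ (oscillation n) = ⟨0, 2 * n, false, 2 * n⟩ := by
  induction n with
  | zero => rfl
  | succ n ih =>
    have h1 := run_replicate_true ⟨0, 2 * n, false, 2 * n⟩ 0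
    have h2 := run_replicate_false ⟨2 * n + 1, 0, true, 2 * n + 1⟩ 0
    simp only [add_zero, zero_add, cond_true, cond_false] at h1 h2
    rw [oscillation, run_append, run_append, ih, h1, h2]
    simp; omega

end RecordState

/-! ### The free regular ⋆-monoid -/

section FreeRegularStar

variable {A : Type*}

theorem starWord_mul (u v : FreeMonoid (A ⊕ A)) :
    starWord (u * v) = starWord v * starWord u := by
  simp [starWord]

theorem starWord_of (c : A ⊕ A) : starWord (FreeMonoid.of c) = FreeMonoid.of c.swap := rfl

theorem starWord_of_pow (c : A ⊕ A) (k : ℕ) :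
    starWord (FreeMonoid.of c ^ k) = FreeMonoid.of c.swap ^ k := by
  induction k with
  | zero => rfl
  | succ k ih => rw [pow_succ, starWord_mul, ih, starWord_of, pow_succ']

theorem inversePowers_of (a : A) :
    InversePowers (PresentedMonoid.of (Rel A) (.inl a)) (PresentedMonoid.of (Rel A) (.inr a)) := by
  have key (c : A ⊕ A) (k : ℕ) : PresentedMonoid.of (Rel A) c ^ k *
      PresentedMonoid.of (Rel A) c.swap ^ k * PresentedMonoid.of (Rel A) c ^ k =
        PresentedMonoid.of (Rel A) c ^ k := by
    have := PresentedMonoid.mk_eq_mk_of_rel (Rel.intro (FreeMonoid.of c ^ k))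
    rwa [starWord_of_pow, map_mul, map_mul, map_pow, map_pow] at this
  exact ⟨key (.inl a), key (.inr a)⟩

/-- The letter `a` or `a⋆` acts on record states as an up-step or a down-step. -/
def moveLetter (c : A ⊕ A) : (Function.End RecordState)ᵐᵒᵖ := .op (RecordState.move c.isLeft)

theorem lift_moveLetter (w : FreeMonoid (A ⊕ A)) (s : RecordState) :
    (FreeMonoid.lift moveLetter w).unop s = s.run (w.toList.map Sum.isLeft) := by
  induction w generalizing s with
  | one => rfl
  | of c => rfl
  | mul u v hu hv =>
    rw [map_mul, MulOpposite.unop_mul, FreeMonoid.toList_mul, List.map_append,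
      RecordState.run_append, ← hu, ← hv]
    rfl

variable (A) in
/-- The right action of the free regular ⋆-monoid on record states. -/
def recordHom : FreeRegularStarMonoid A →* (Function.End RecordState)ᵐᵒᵖ :=
  PresentedMonoid.lift moveLetter <| by
    rintro _ w ⟨⟩
    apply MulOpposite.unop_injective
    funext s
    have e : (starWord w).toList.map Sum.isLeft = ((w.toList.map Sum.isLeft).map not).reverse := by
      simp [starWord, Function.comp_def]
    simp only [lift_moveLetter, FreeMonoid.toList_mul, List.map_append, RecordState.run_append, e]
    exact (RecordState.run_retrace _ s).1

theorem recordHom_of_pow (c : A ⊕ A) (k : ℕ) (s : RecordState) :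
    (recordHom A (PresentedMonoid.of (Rel A) c ^ k)).unop s =
      s.run (List.replicate k c.isLeft) := by
  induction k generalizing s with
  | zero => rfl
  | succ k ih =>
    rw [pow_succ', map_mul, List.replicate_succ, RecordState.run_cons, ← ih]
    rfl

theorem count_recordHom_le (a : A) (n : ℕ) {x : FreeRegularStarMonoid A}
    (hx : x ∈ runs (PresentedMonoid.of (Rel A) (.inl a)) (PresentedMonoid.of (Rel A) (.inr a)) ^ n)
    (s : RecordState) : ((recordHom A x).unop s).count ≤ s.count + n := by
  induction n generalizing x with
  | zero => rw [pow_zero, Set.mem_one] at hx; subst hx; exact le_rfl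
  | succ n ih =>
    rw [pow_succ] at hx
    obtain ⟨y, hy, z, ⟨k, hz⟩, rfl⟩ := hx
    have h1 := ih hy
    have h2 : ∃ c : A ⊕ A, z = PresentedMonoid.of (Rel A) c ^ k := by
      rcases hz with hz | hz
      exacts [⟨_, hz⟩, ⟨_, hz⟩]
    obtain ⟨c, rfl⟩ := h2
    have h3 := RecordState.count_run_replicate_le ((recordHom A y).unop s) c.isLeft k
    rw [← recordHom_of_pow] at h3
    simp only [map_mul, MulOpposite.unop_mul]
    exact h3.trans (by omega)

/-- The number of runs is unbounded on the submonoid generated by `a` and `a⋆`. -/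
theorem exists_mem_closure_notMem_runs_pow (a : A) (n : ℕ) :
    ∃ x ∈ Submonoid.closure {PresentedMonoid.of (Rel A) (.inl a),
        PresentedMonoid.of (Rel A) (.inr a)},
      x ∉ runs (PresentedMonoid.of (Rel A) (.inl a)) (PresentedMonoid.of (Rel A) (.inr a)) ^ n := by
  set α := PresentedMonoid.of (Rel A) (.inl a)
  set β := PresentedMonoid.of (Rel A) (.inr a)
  have hrun (w : List Bool) (s : RecordState) :
      (recordHom A (pathEval α β w)).unop s = s.run w := by
    induction w generalizing s with
    | nil => rfl
    | cons c w ih =>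
      cases c
      · rw [pathEval_false, map_mul, RecordState.run_cons, ← ih]; rfl
      · rw [pathEval_true, map_mul, RecordState.run_cons, ← ih]; rfl
  refine ⟨pathEval α β (RecordState.oscillation (n + 1)), ?_, fun h => ?_⟩
  · exact eval_mem _ _ fun c _ => Submonoid.subset_closure (by cases c <;> simp)
  · have := count_recordHom_le a n h ⟨0, 0, false, 0⟩
    rw [hrun, RecordState.run_oscillation] at this
    simp at this; omega

/-- The indicator of the letters `a` and `a⋆`. -/
noncomputable def letterIndicator (a : A) (c : A ⊕ A) : ℕ :=
  open Classical in if c.elim id id = a then 1 else 0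

/-- The homomorphism to `ℕ` whose value is `1` at the products of the generators `a` and `a⋆`, and
`0` elsewhere. -/
noncomputable def indicatorHom (a : A) : FreeRegularStarMonoid A →* ℕ :=
  PresentedMonoid.lift (letterIndicator a) <| by
    rintro _ w ⟨⟩
    have h2 (w) : IsIdempotentElem (FreeMonoid.lift (letterIndicator a) w) := by
      induction w with
      | one => exact .one
      | of c => by_cases h : c.elim id id = a <;> simp [letterIndicator, h, IsIdempotentElem]
      | mul u v hu hv => rw [map_mul]; exact hu.mul hv
    have h1 (w) : FreeMonoid.lift (letterIndicator a) (starWord w) =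
        FreeMonoid.lift (letterIndicator a) w := by
      induction w with
      | one => rfl
      | of c => cases c <;> rfl
      | mul u v hu hv => rw [starWord_mul, map_mul, map_mul, hu, hv, mul_comm]
    rw [map_mul, map_mul, h1, h2 w, h2 w]

theorem indicatorHom_eq_one_iff (a : A) (x : FreeRegularStarMonoid A) :
    indicatorHom a x = 1 ↔ x ∈ Submonoid.closure {PresentedMonoid.of (Rel A) (.inl a),
      PresentedMonoid.of (Rel A) (.inr a)} := by
  have hof (c : A ⊕ A) : indicatorHom a (PresentedMonoid.of (Rel A) c) = letterIndicator a c := rfl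
  constructor
  · induction x using PresentedMonoid.inductionOn with | _ w
    induction w with
    | one => exact fun _ => Submonoid.one_mem _
    | of c =>
      intro h
      replace h := (hof c).symm.trans h
      refine Submonoid.subset_closure ?_
      obtain rfl : c.elim id id = a := by simpa [letterIndicator] using h
      cases c
      exacts [.inl rfl, .inr rfl]
    | mul u v hu hv =>
      intro h
      rw [map_mul, map_mul, mul_eq_one] at h
      rw [map_mul]
      exact Submonoid.mul_mem _ (hu h.1) (hv h.2)
  · intro h
    induction h using Submonoid.closure_induction with
    | mem x hx => rcases hx with rfl | rfl <;> simp [hof, letterIndicator]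
    | one => exact map_one _
    | mul x y _ _ hx hy => rw [map_mul, hx, hy]

theorem mem_closure_of_eval_mem (a : A) {B : Type*} {f : B → FreeRegularStarMonoid A} {w : List B}
    (h : eval f w ∈ Submonoid.closure {PresentedMonoid.of (Rel A) (.inl a),
      PresentedMonoid.of (Rel A) (.inr a)}) : ∀ b ∈ w,
    f b ∈ Submonoid.closure {PresentedMonoid.of (Rel A) (.inl a),
      PresentedMonoid.of (Rel A) (.inr a)} := by
  simp only [← indicatorHom_eq_one_iff] at *
  induction w with
  | nil => simp
  | cons b w ih =>
    rw [eval_cons, map_mul, mul_eq_one] at h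
    simpa using ⟨h.1, ih h.2⟩

end FreeRegularStar

/-! ### Loops in a deterministic automaton -/

section Automata

variable {B σ : Type*} (D : DFA B σ)

/-- A word is cut at the last visit to the state from which it is read. -/
theorem exists_last_visit (s : σ) (w : List B) :
    ∃ u v, w = u ++ v ∧ D.evalFrom s u = s ∧ ∀ p, p <+: v → p ≠ [] → D.evalFrom s p ≠ s := by
  by_cases h : ∃ p, p <+: w ∧ p ≠ [] ∧ D.evalFrom s p = s
  · obtain ⟨p, ⟨w', e⟩, hp, hs⟩ := h
    have := List.length_pos_iff.2 hp
    obtain ⟨u, v, e', hu, hv⟩ := exists_last_visit s w'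
    exact ⟨p ++ u, v, by rw [← e, e', List.append_assoc],
      by rw [D.evalFrom_of_append, hs, hu], hv⟩
  · push Not at h
    exact ⟨[], w, rfl, rfl, h⟩
  termination_by w.length
  decreasing_by rw [← e, List.length_append]; omega

/-- If any two loops at a state commute, then all of them are powers of a shortest one. -/
theorem exists_loop_generator (s : σ)
    (hcomm : ∀ x y, D.evalFrom s x = s → D.evalFrom s y = s → x ++ y = y ++ x) :
    ∃ p, ∀ x, D.evalFrom s x = s → ∃ k, x = (List.replicate k p).flatten := by
  classical
  by_cases h : ∃ n, ∃ x, x ≠ [] ∧ D.evalFrom s x = s ∧ x.length = n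
  · obtain ⟨p, hp, hs, hn⟩ := Nat.find_spec h
    have hmin (x : List B) (hx : x ≠ []) (hxs : D.evalFrom s x = s) : p.length ≤ x.length :=
      hn ▸ Nat.find_min' h ⟨x, hx, hxs, rfl⟩
    refine ⟨p, fun x hx => ?_⟩
    induction hl : x.length using Nat.strong_induction_on generalizing x with
    | _ l ih =>
      by_cases hx0 : x = []
      · exact ⟨0, by simpa using hx0⟩
      · have hpre : p <+: x := List.prefix_of_prefix_length_le (l₃ := x ++ p)
          ⟨x, hcomm p x hs hx⟩ ⟨p, rfl⟩ (hmin x hx0 hx)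
        obtain ⟨x', rfl⟩ := hpre
        have := List.length_pos_iff.2 hp
        rw [D.evalFrom_of_append, hs] at hx
        obtain ⟨k, hk⟩ := ih x'.length (by rw [← hl, List.length_append]; omega) x' hx rfl
        exact ⟨k + 1, by rw [List.replicate_succ, List.flatten_cons, ← hk]⟩
  · refine ⟨[], fun x hx => ⟨0, ?_⟩⟩
    by_contra hx0
    exact h ⟨_, x, by simpa using hx0, hx, rfl⟩

theorem evalFrom_flatten_replicate {s : σ} {x : List B} (hx : D.evalFrom s x = s) (k : ℕ) :
    D.evalFrom s (List.replicate k x).flatten = s := by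
  induction k with
  | zero => rfl
  | succ k ih => rw [List.replicate_succ, List.flatten_cons, D.evalFrom_of_append, hx, ih]

/-- The states that lie on the path of an accepted word. -/
def usefulStates : Set σ :=
  {s | (∃ u, D.evalFrom D.start u = s) ∧ ∃ v, D.evalFrom s v ∈ D.accept}

variable {M : Type*} [Monoid M] {f : B → M}

/-- Over a monoid without free submonoids of rank two, unique normal forms make any two loops at a
useful state commute. -/
theorem loops_commute (hinj : ∀ u ∈ D.accepts, ∀ v ∈ D.accepts, eval f u = eval f v → u = v)
    {s : σ} (hs : s ∈ usefulStates D) {x y : List B} (hx : D.evalFrom s x = s)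
    (hy : D.evalFrom s y = s)
    (hfree : (∃ n : ℕ, eval f x ^ n * eval f y * eval f x ^ (n + 1) =
      eval f x ^ (n + 1) * eval f y * eval f x ^ n) ∨ eval f x ^ 3 = eval f x ^ 4) :
    x ++ y = y ++ x := by
  obtain ⟨⟨u, hu⟩, v, hv⟩ := hs
  have key (a b : List B) (ha : D.evalFrom s a = s) (hb : D.evalFrom s b = s)
      (hab : eval f a = eval f b) : a = b := by
    have mem (c : List B) (hc : D.evalFrom s c = s) : u ++ c ++ v ∈ D.accepts := by
      rw [DFA.mem_accepts, DFA.eval, D.evalFrom_of_append, D.evalFrom_of_append, hu, hc]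
      exact hv
    have := hinj _ (mem a ha) _ (mem b hb) (by simp [hab])
    exact List.append_cancel_left (List.append_cancel_right this)
  have hpow := evalFrom_flatten_replicate D hx
  rcases hfree with ⟨n, hn⟩ | h
  · have := key ((List.replicate n x).flatten ++ y ++ (List.replicate (n + 1) x).flatten)
      ((List.replicate (n + 1) x).flatten ++ y ++ (List.replicate n x).flatten)
      (by simp only [D.evalFrom_of_append, hpow, hy])
      (by simp only [D.evalFrom_of_append, hpow, hy])
      (by simpa only [eval_append, eval_flatten_replicate] using hn)
    have e : (List.replicate (n + 1) x).flatten = x ++ (List.replicate n x).flatten := rfl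
    have e' : x ++ (List.replicate n x).flatten = (List.replicate n x).flatten ++ x := by
      rw [← e, List.replicate_succ']; simp
    rw [e] at this
    nth_rewrite 2 [e'] at this
    simp only [List.append_assoc, List.append_cancel_left_eq] at this
    simp only [← List.append_assoc] at this
    exact (List.append_cancel_right this).symm
  · have := congrArg List.length (key (List.replicate 3 x).flatten (List.replicate 4 x).flatten
      (hpow 3) (hpow 4) (by simpa only [eval_flatten_replicate] using h))
    obtain rfl : x = [] := by simpa using this
    simp

/-- Let a set `S` contain `1`, and let the powers of each element of a submonoid `N` without free
submonoids of rank two be products of boundedly many factors from `S`. If each word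
of a regular language takes its value in `N`, and different words take different values, then these
values are products of boundedly many factors from `S` as well. -/
theorem exists_eval_mem_pow [Finite B] [Finite σ] {S : Set M} (hS : 1 ∈ S) {N : Submonoid M}
    (hpow : ∀ X ∈ N, ∃ n, ∀ k : ℕ, X ^ k ∈ S ^ n)
    (hfree : ∀ X ∈ N, ∀ Y ∈ N, (∃ n : ℕ, X ^ n * Y * X ^ (n + 1) = X ^ (n + 1) * Y * X ^ n) ∨
      X ^ 3 = X ^ 4)
    (hf : ∀ b, f b ∈ N)
    (hinj : ∀ u ∈ D.accepts, ∀ v ∈ D.accepts, eval f u = eval f v → u = v) :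
    ∃ n, ∀ w ∈ D.accepts, eval f w ∈ S ^ n := by
  classical
  have hN (w : List B) : eval f w ∈ N := eval_mem f N fun b _ => hf b
  have hmono {m n : ℕ} (h : m ≤ n) : S ^ m ⊆ S ^ n := Set.pow_subset_pow_right hS h
  have hletter : ∃ n, ∀ b, f b ∈ S ^ n := by
    choose n hn using fun b => hpow (f b) (hf b)
    obtain ⟨m, hm⟩ := (Set.finite_range n).bddAbove
    exact ⟨m, fun b => hmono (hm ⟨b, rfl⟩) (by simpa using hn b 1)⟩
  have hloop : ∃ n, ∀ s ∈ usefulStates D, ∀ x, D.evalFrom s x = s → eval f x ∈ S ^ n := by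
    have (s : σ) : ∃ n, s ∈ usefulStates D → ∀ x, D.evalFrom s x = s → eval f x ∈ S ^ n := by
      by_cases hs : s ∈ usefulStates D
      · obtain ⟨p, hp⟩ := exists_loop_generator D s fun x y hx hy =>
          loops_commute D hinj hs hx hy (hfree _ (hN x) _ (hN y))
        obtain ⟨n, hn⟩ := hpow _ (hN p)
        refine ⟨n, fun _ x hx => ?_⟩
        obtain ⟨k, rfl⟩ := hp x hx
        rw [eval_flatten_replicate]
        exact hn k
      · exact ⟨0, fun h => absurd h hs⟩
    choose n hn using this
    obtain ⟨m, hm⟩ := (Set.finite_range n).bddAbove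
    exact ⟨m, fun s hs x hx => hmono (hm ⟨s, rfl⟩) (hn s hs x hx)⟩
  obtain ⟨c, hc⟩ := hletter
  obtain ⟨d, hd⟩ := hloop
  -- Each state costs one loop and one letter, because it is never met again after its last visit.
  have main (n : ℕ) : ∀ (T : Finset σ) (s : σ) (w : List B), T.card ≤ n →
      (∀ p, p <+: w → D.evalFrom s p ∈ T ∧ D.evalFrom s p ∈ usefulStates D) →
        eval f w ∈ S ^ (n * (d + c)) := by
    induction n with
    | zero =>
      intro T s w hT hw
      have := (hw [] List.nil_prefix).1
      rw [Finset.card_eq_zero.1 (Nat.le_zero.1 hT)] at this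
      simp at this
    | succ n ih =>
      intro T s w hT hw
      obtain ⟨hsT, hsU⟩ := hw [] List.nil_prefix
      rw [D.evalFrom_nil] at hsT hsU
      obtain ⟨u, v, rfl, hu, hv⟩ := exists_last_visit D s w
      have hu' := hd s hsU u hu
      cases v with
      | nil =>
        rw [List.append_nil]
        exact hmono (by rw [add_mul]; omega) hu'
      | cons b v =>
        have hv' := ih (T.erase s) (D.step s b) v (by rw [Finset.card_erase_of_mem hsT]; omega)
          fun p hp => by
            have h1 := hw (u ++ b :: p)
              ((List.prefix_append_right_inj u).2 (List.prefix_cons_inj b |>.2 hp))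
            rw [D.evalFrom_of_append, hu, D.evalFrom_cons] at h1
            have h2 := hv (b :: p) (List.prefix_cons_inj b |>.2 hp) (by simp)
            exact ⟨Finset.mem_erase.2 ⟨by rwa [D.evalFrom_cons] at h2, h1.1⟩, h1.2⟩
        rw [eval_append, eval_cons, ← mul_assoc,
          show (n + 1) * (d + c) = d + c + n * (d + c) by ring, pow_add, pow_add]
        exact Set.mul_mem_mul (Set.mul_mem_mul hu' (hc b)) hv'
  have := Fintype.ofFinite σ
  refine ⟨Fintype.card σ * (d + c), fun w hw => main _ Finset.univ D.start w le_rfl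
    fun p hp => ⟨Finset.mem_univ _, ⟨p, rfl⟩, ?_⟩⟩
  obtain ⟨q, rfl⟩ := hp
  exact ⟨q, by rw [← D.evalFrom_of_append]; exact hw⟩

end Automata

/-! ### The submonoid generated by one letter has no regular normal forms -/

theorem not_isRational (A : Type*) [Nonempty A] : ¬ IsRational (FreeRegularStarMonoid A) := by
  rintro ⟨B, _, f, L, ⟨σ, _, D, rfl⟩, hL⟩
  obtain ⟨a⟩ := ‹Nonempty A›
  have hinv := inversePowers_of a
  -- The words over the letters that take their value in the submonoid generated by `a` and `a⋆`
  -- are a regular language of unique normal forms of this submonoid.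
  let N := Submonoid.closure {PresentedMonoid.of (Rel A) (.inl a),
    PresentedMonoid.of (Rel A) (.inr a)}
  let D' : DFA {b : B // f b ∈ N} σ := D.comap Subtype.val
  have hmem (w : List {b : B // f b ∈ N}) : w ∈ D'.accepts ↔ w.map Subtype.val ∈ D.accepts := by
    rw [DFA.accepts_comap]; rfl
  have heval (w : List {b : B // f b ∈ N}) :
      eval (fun b : {b : B // f b ∈ N} => f b) w = eval f (w.map Subtype.val) := by
    simp [eval]
  obtain ⟨n, hn⟩ := exists_eval_mem_pow D' (f := fun b => f b)
    (one_mem_runs (PresentedMonoid.of (Rel A) (.inl a)) (PresentedMonoid.of (Rel A) (.inr a)))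
    (N := N) (fun X hX => hinv.exists_pow_mem_runs hX) (fun X hX Y hY => hinv.not_free hX hY)
    (fun b => b.2) fun u hu v hv huv => by
      rw [heval, heval] at huv
      exact List.map_injective_iff.2 Subtype.val_injective
        ((hL _).unique ⟨(hmem u).1 hu, rfl⟩ ⟨(hmem v).1 hv, huv.symm⟩)
  obtain ⟨x, hxN, hx⟩ := exists_mem_closure_notMem_runs_pow a n
  obtain ⟨w, ⟨hw, rfl⟩, -⟩ := hL x
  lift w to List {b : B // f b ∈ N} using mem_closure_of_eval_mem a hxN
  exact hx (heval w ▸ hn w ((hmem w).2 hw))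

/-! ### Regular normal forms in automatic monoids -/

section Automatic

/-- The words that a letter-to-letter map `i` sends into the image of a regular language under a
letter-to-letter map `g` form a regular language. -/
theorem isRegular_projection {B C D : Type*} {K : Language C} (hK : K.IsRegular) (g : C → D)
    (i : B → D) :
    Language.IsRegular ({u | ∃ y ∈ K, y.map g = u.map i} : Set (List B)) := by
  obtain ⟨σ, _, P, rfl⟩ := hK
  let Q : NFA B σ :=
    { step := fun s b => {t | ∃ c, g c = i b ∧ P.step s c = t}
      start := {P.start}
      accept := P.accept }
  have key (u : List B) (s t : σ) :
      t ∈ Q.evalFrom {s} u ↔ ∃ y : List C, y.map g = u.map i ∧ P.evalFrom s y = t := by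
    induction u generalizing s with
    | nil => simp [eq_comm]
    | cons b u ih =>
      rw [NFA.evalFrom_cons, NFA.stepSet_singleton, NFA.mem_evalFrom_iff_exists]
      constructor
      · rintro ⟨_, ⟨c, hc, rfl⟩, h⟩
        obtain ⟨y, hy, rfl⟩ := (ih _).1 h
        exact ⟨c :: y, by simp [hc, hy], rfl⟩
      · rintro ⟨y, hy, rfl⟩
        obtain ⟨c, y, rfl, hc, hy⟩ := List.map_eq_cons_iff.1 hy
        exact ⟨_, ⟨c, hc, rfl⟩, (ih _).2 ⟨y, hy, rfl⟩⟩
  classical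
  refine ⟨Set σ, inferInstance, Q.toDFA, ?_⟩
  rw [NFA.toDFA_correct]
  ext u
  rw [NFA.mem_accepts]
  constructor
  · rintro ⟨t, ht, h⟩
    obtain ⟨y, hy, rfl⟩ := (key u _ _).1 h
    exact ⟨y, ht, hy⟩
  · rintro ⟨y, hy, h⟩
    exact ⟨_, hy, (key u _ _).2 ⟨y, h, rfl⟩⟩

variable {B : Type*}

/-- The automaton that reads a padded pair `(u, v)` and decides whether `v` precedes `u` in the
shortlex order. Its state is the order of `v` and `u` as far as they have been read. -/
def shortlexDFA [LinearOrder B] : DFA (Option B × Option B) Ordering where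
  step
    | o, (some a, some b) => o.then (cmp b a)
    | _, (some _, none) => .lt
    | _, (none, some _) => .gt
    | o, (none, none) => o
  start := .eq
  accept := {.lt}

theorem evalFrom_shortlexDFA [LinearOrder B] (u v : List B) (o : Ordering) :
    shortlexDFA.evalFrom o (padPair u v) = .lt ↔ v.length < u.length ∨
      v.length = u.length ∧ (o = .lt ∨ o = .eq ∧ List.Lex (· < ·) v u) := by
  induction u, v using padPair.induct generalizing o with
  | case1 => simp [padPair]
  | case2 a u ih =>
    rw [padPair, DFA.evalFrom_cons, ih]
    simp [shortlexDFA]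
    omega
  | case3 b v ih =>
    rw [padPair, DFA.evalFrom_cons, ih]
    simp [shortlexDFA]
  | case4 a u b v ih =>
    rw [padPair, DFA.evalFrom_cons, ih]
    simp only [List.length_cons, add_lt_add_iff_right, add_left_inj, shortlexDFA]
    have e : List.Lex (· < ·) (b :: v) (a :: u) ↔ b < a ∨ b = a ∧ List.Lex (· < ·) v u :=
      List.cons_lt_cons_iff
    rw [e]
    refine or_congr_right (and_congr_right fun _ => ?_)
    rcases lt_trichotomy b a with h | rfl | h
    · cases o <;> simp [h.cmp_eq_lt, h]
    · cases o <;> simp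
    · cases o <;> simp [h.cmp_eq_gt, h.not_gt, h.ne']

theorem padPair_mem_accepts_shortlexDFA [LinearOrder B] (u v : List B) :
    padPair u v ∈ (shortlexDFA (B := B)).accepts ↔ List.Shortlex (· < ·) v u := by
  have := evalFrom_shortlexDFA u v .eq
  rw [List.shortlex_def]
  exact this.trans (by simp)

theorem map_fst_padPair_iff (u v w : List B) :
    (padPair u v).map Prod.fst = w.map some ↔ u = w ∧ v.length ≤ u.length := by
  induction u, v using padPair.induct generalizing w with
  | case1 => cases w <;> simp [padPair]
  | case2 a u ih => cases w <;> simp [padPair, ih]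
  | case3 b v ih => cases w <;> simp [padPair]
  | case4 a u b v ih => cases w <;> simp [padPair, ih, and_assoc]

/-- In an automatic monoid, the shortlex-least representatives of the elements form a regular
language. -/
theorem IsAutomatic.isRational {M : Type*} [Monoid M] (h : IsAutomatic M) : IsRational M := by
  obtain ⟨B, _, f, L, hL, hsurj, hE, -⟩ := h
  have := Fintype.ofFinite B
  let _ : LinearOrder B := LinearOrder.lift' (Fintype.equivFin B) (Fintype.equivFin B).injective
  have hS : (shortlexDFA (B := B)).accepts.IsRegular := ⟨_, inferInstance, _, rfl⟩
  have hP := isRegular_projection (hE.inf hS) Prod.fst (some : B → Option B)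
  have hmem (u : List B) :
      (∃ y ∈ pairLanguage L (fun u v => eval f u = eval f v) ⊓ (shortlexDFA (B := B)).accepts,
        y.map Prod.fst = u.map some) ↔
      u ∈ L ∧ ∃ v ∈ L, eval f u = eval f v ∧ List.Shortlex (· < ·) v u := by
    constructor
    · rintro ⟨_, ⟨⟨u', hu, v, hv, huv, rfl⟩, hlt⟩, hy⟩
      obtain ⟨rfl, -⟩ := (map_fst_padPair_iff _ _ _).1 hy
      exact ⟨hu, v, hv, huv, (padPair_mem_accepts_shortlexDFA _ _).1 hlt⟩
    · rintro ⟨hu, v, hv, huv, hlt⟩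
      refine ⟨padPair u v, ⟨⟨u, hu, v, hv, huv, rfl⟩,
        (padPair_mem_accepts_shortlexDFA _ _).2 hlt⟩, (map_fst_padPair_iff _ _ _).2 ⟨rfl, ?_⟩⟩
      rcases List.shortlex_def.1 hlt with h | h
      exacts [h.le, h.1.le]
  refine ⟨B, inferInstance, f, _, hL.inf hP.compl, fun m => ?_⟩
  have hwf : WellFounded (List.Shortlex ((· < ·) : B → B → Prop)) := List.Shortlex.wf wellFounded_lt
  have hne : {w | w ∈ L ∧ eval f w = m}.Nonempty := hsurj m
  have hmin {x : List B} (hx : x ∈ {w | w ∈ L ∧ eval f w = m}) :=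
    hwf.not_lt_min {w | w ∈ L ∧ eval f w = m} hx
  obtain ⟨hw, hwm⟩ := hwf.min_mem _ hne
  set w := hwf.min _ hne
  refine ⟨w, ⟨⟨hw, fun h => ?_⟩, hwm⟩, ?_⟩
  · obtain ⟨-, v, hv, hvw, hlt⟩ := (hmem w).1 h
    exact hmin ⟨hv, hvw.symm.trans hwm⟩ hlt
  · rintro u ⟨⟨hu, hu'⟩, hum⟩
    by_contra hne
    rcases trichotomous_of (List.Shortlex (· < ·)) u w with h | h | h
    · exact hmin ⟨hu, hum⟩ h
    · exact hne h
    · exact hu' ((hmem u).2 ⟨hu, w, hw, hum.trans hwm.symm, h⟩)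

end Automatic

end RegularStar

theorem mainTheorem3 (A : Type*) [Nonempty A] :
    ¬ RegularStar.IsRational (RegularStar.FreeRegularStarMonoid A) ∧
      ¬ RegularStar.IsAutomatic (RegularStar.FreeRegularStarMonoid A) :=
  ⟨RegularStar.not_isRational A, fun h => RegularStar.not_isRational A h.isRational⟩
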